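/- **Theorem (Local-Global).** Let $C$ be a finite, locally distributive derived forest category. Then there is a finite distributive forest algebra $(H,V)$ such that $C \prec (H,V)$. The notions are as follows. *Forest algebras.* A forest algebra $(H,V)$ consists of a commutative monoid $(H,+,0)$ with $h+h=h$ for all $h$, a monoid $(V,\cdot,1)$, a faithful action of $V$ on $H$, and a map $h\mapsto I_h$ from $H$ to $V$ with $I_h h'=h+h'$, such that every $h\in H$ is of the form $v\cdot 0$. Write $h+v=v+h:=I_h v$. It is finite if $H$ and $V$ are finite, and distributive if $v(h_1+h_2)=vh_1+vh_2$ for all $v\in V$ and $h_1,h_2\in H$. A morphism is a pair of monoid morphisms that respects the action and the map $I$; it is surjective if both maps are. For a finite alphabet $\Sigma$, the free forest algebra $\Sigma^\Delta=(H_\Sigma,V_\Sigma)$ consists of the finite $\Sigma$-labelled forests, taken without regard to order and multiplicity of siblings, and of the contexts, that is, forests with exactly one leaf labelled by a variable; the operations are union and substitution for the variable. *Derived forest categories.* A derived forest category is a category $C=D_{\alpha,\beta}$, where $\alpha:\Sigma^\Delta\to(H_1,V_1)$ and $\beta:\Sigma^\Delta\to(H_2,V_2)$ are surjective morphisms of forest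 algebras and $\Sigma$ is a finite alphabet. Its objects are the elements of $H_2$. Its arrows $h\to h'$ are the classes $[h,p,h']$ of triples with $p\in V_\Sigma$ and $\beta(p)h=h'$, where $(h,p,h')\sim(h,q,h')$ if $\alpha(ps)=\alpha(qs)$ for all $s\in H_\Sigma$ with $\beta(s)=h$. Its half-arrows are the pairs $(\alpha(s),\beta(s))$ with $s\in H_\Sigma$; the half-arrow $(c,h)$ ends in the object $h$. The operations are - $[h_2,p,h_3]\cdot[h_1,q,h_2]=[h_1,pq,h_3]$, - $[h,p,h']\cdot(c,h)=(\alpha(p)c,h')$, - $(c,h)+(d,k)=(c+d,h+k)$, - $[h,p,h']+(\alpha(s),\beta(s))=(\alpha(s),\beta(s))+[h,p,h']=[h,p+s,h'+\beta(s)]$. $C$ is finite if it has finitely many objects, arrows and half-arrows. $C$ is locally distributive if $v\cdot(c+d)=v\cdot c+v\cdot d$ for all objects $h,h'$, all arrows $v:h\to h'$ and all half-arrows $c,d$ that end in $h$. *Division.* $C\prec(H,V)$ ($C$ divides $(H,V)$) means that there are nonempty sets $K_c\subseteq H$ for all half-arrows $c$ and $K_e\subseteq V$ for all arrows $e$ of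 $C$ such that 1. for all half-arrows $c,d$ and all arrows $e,f$ one has $K_f\cdot K_e\subseteq K_{f\cdot e}$ whenever $e$ ends where $f$ starts, $K_e\cdot K_c\subseteq K_{e\cdot c}$ whenever $c$ ends where $e$ starts, $K_c+K_d\subseteq K_{c+d}$, $K_c+K_f\subseteq K_{c+f}$ and $K_f+K_c\subseteq K_{f+c}$; 2. $K_e\cap K_{e'}=\emptyset$ for distinct arrows $e,e'$ with the same start and the same end, and $K_c\cap K_{c'}=\emptyset$ for distinct half-arrows $c,c'$ with the same end. -/

import Mathlib

universe u v u₁ v₁ u₂ v₂ w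

/-! ### Forest algebras -/

/-- A (horizontally commutative and idempotent) forest algebra `(H, V)`: a commutative idempotent
monoid `H` of forest types, a monoid `V` of context types, a faithful action of `V` on `H`, and for
each `h` an element `ins h` of `V` that acts as `h' ↦ h + h'`. -/
structure ForestAlgebra where
  H : Type u
  V : Type v
  [addH : AddCommMonoid H]
  [monV : Monoid V]
  [act : MulAction V H]
  [faithful : FaithfulSMul V H]
  add_idem : ∀ h : H, h + h = h
  ins : H → V
  ins_smul : ∀ h h' : H, ins h • h' = h + h'
  exists_smul_zero : ∀ h : H, ∃ v : V, h = v • (0 : H)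

namespace ForestAlgebra

attribute [instance] ForestAlgebra.addH ForestAlgebra.monV ForestAlgebra.act
  ForestAlgebra.faithful

/-- The element `h + v = v + h` of `V`, that is, `I_h · v`. -/
def hadd (F : ForestAlgebra.{u, v}) (h : F.H) (v : F.V) : F.V := F.ins h * v

/-- `v (h₁ + h₂) = v h₁ + v h₂` for all context types `v` and forest types `h₁`, `h₂`. -/
def IsDistributive (F : ForestAlgebra.{u, v}) : Prop :=
  ∀ (v : F.V) (h₁ h₂ : F.H), v • (h₁ + h₂) = v • h₁ + v • h₂

/-- Both the forest types and the context types are finite in number. -/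
def IsFinite (F : ForestAlgebra.{u, v}) : Prop := Finite F.H ∧ Finite F.V

/-- Morphisms of forest algebras. -/
structure Hom (F : ForestAlgebra.{u₁, v₁}) (G : ForestAlgebra.{u₂, v₂}) where
  mapH : F.H →+ G.H
  mapV : F.V →* G.V
  map_smul : ∀ (v : F.V) (h : F.H), mapH (v • h) = mapV v • mapH h
  map_ins : ∀ h : F.H, mapV (F.ins h) = G.ins (mapH h)

/-- A morphism is surjective if it is surjective on forest types and on context types. -/
def Hom.Surjective {F : ForestAlgebra.{u₁, v₁}} {G : ForestAlgebra.{u₂, v₂}} (φ : Hom F G) :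
    Prop :=
  Function.Surjective φ.mapH ∧ Function.Surjective φ.mapV

end ForestAlgebra

/-! ### Forests and contexts over an alphabet -/

/-- Finite ordered forests with node labels in `A`: either empty, or a first tree, given by its
root label and the forest of its children, followed by the remaining trees. -/
inductive PreForest (A : Type u) : Type u
  | nil : PreForest A
  | cons (a : A) (children siblings : PreForest A) : PreForest A

namespace PreForest

variable {A : Type u}

/-- Equality of forests without regard to order and multiplicity of siblings: the least congruence
that allows two neighbouring siblings to be exchanged and equal neighbouring siblings to be
identified. -/
inductive Equiv : PreForest A → PreForest A → Prop
  | refl (s) : Equiv s s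
  | symm {s t} : Equiv s t → Equiv t s
  | trans {s t r} : Equiv s t → Equiv t r → Equiv s r
  | cons (a : A) {c c' s s'} : Equiv c c' → Equiv s s' → Equiv (cons a c s) (cons a c' s')
  | swap (a b : A) (c d s) : Equiv (cons a c (cons b d s)) (cons b d (cons a c s))
  | dup (a : A) (c s) : Equiv (cons a c (cons a c s)) (cons a c s)

/-- Juxtaposition of ordered forests. -/
def append : PreForest A → PreForest A → PreForest A
  | nil, t => t
  | cons a c s, t => cons a c (append s t)

theorem append_nil (s : PreForest A) : append s nil = s := by
  induction s with
  | nil => rfl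
  | cons a c s _ ih => simp [append, ih]

theorem append_assoc (s t r : PreForest A) :
    append (append s t) r = append s (append t r) := by
  induction s with
  | nil => rfl
  | cons a c s _ ih => simp [append, ih]

theorem append_congr_left {s s' : PreForest A} (h : Equiv s s') (t : PreForest A) :
    Equiv (append s t) (append s' t) := by
  induction h with
  | refl s => exact .refl _
  | symm _ ih => exact .symm ih
  | trans _ _ ih₁ ih₂ => exact .trans ih₁ ih₂
  | cons a hc _ _ ih => exact .cons a hc ih
  | swap a b c d s => exact .swap a b c d _
  | dup a c s => exact .dup a c _

theorem append_congr_right (s : PreForest A) {t t' : PreForest A} (h : Equiv t t') :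
    Equiv (append s t) (append s t') := by
  induction s with
  | nil => exact h
  | cons a c s _ ih => exact .cons a (.refl c) ih

theorem append_cons (s : PreForest A) (a : A) (c t : PreForest A) :
    Equiv (append s (cons a c t)) (cons a c (append s t)) := by
  induction s with
  | nil => exact .refl _
  | cons b d s _ ih => exact .trans (.cons b (.refl d) ih) (.swap b a d c _)

theorem append_comm (s t : PreForest A) : Equiv (append s t) (append t s) := by
  induction s with
  | nil => rw [append_nil]; exact .refl _
  | cons a c s _ ih => exact .trans (.cons a (.refl c) ih) (.symm (append_cons t a c s))

theorem append_self (s : PreForest A) : Equiv (append s s) s := by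
  induction s with
  | nil => exact .refl _
  | cons a c s _ ih =>
    exact .trans (.cons a (.refl c) (append_cons s a c s))
      (.trans (.dup a c _) (.cons a (.refl c) ih))

instance setoid (A : Type u) : Setoid (PreForest A) := ⟨Equiv, .refl, .symm, .trans⟩

end PreForest

/-- Finite forests with node labels in `A`, without regard to order and multiplicity of siblings;
the monoid operation is union and the neutral element is the empty forest. -/
def Forest (A : Type u) : Type u := Quotient (PreForest.setoid A)

namespace Forest

variable {A : Type u}

instance : Zero (Forest A) := ⟨Quotient.mk _ PreForest.nil⟩

instance : Add (Forest A) :=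
  ⟨Quotient.map₂ PreForest.append fun _ s' h _ _ h' =>
    PreForest.Equiv.trans (PreForest.append_congr_left h _) (PreForest.append_congr_right s' h')⟩

instance : AddCommMonoid (Forest A) where
  add_assoc s t r := by
    induction s using Quotient.ind
    induction t using Quotient.ind
    induction r using Quotient.ind
    exact congrArg (Quotient.mk _) (PreForest.append_assoc _ _ _)
  zero_add s := by
    induction s using Quotient.ind
    rfl
  add_zero s := by
    induction s using Quotient.ind
    exact congrArg (Quotient.mk _) (PreForest.append_nil _)
  add_comm s t := by
    induction s using Quotient.ind
    induction t using Quotient.ind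
    exact Quotient.sound (PreForest.append_comm _ _)
  nsmul := nsmulRec

theorem add_self (s : Forest A) : s + s = s := by
  induction s using Quotient.ind
  exact Quotient.sound (PreForest.append_self _)

/-- The forest that consists of the single tree `a[c]`, with root label `a` and children `c`. -/
def tree (a : A) (c : Forest A) : Forest A :=
  Quotient.map (fun c => PreForest.cons a c PreForest.nil)
    (fun _ _ h => PreForest.Equiv.cons a h (.refl _)) c

@[elab_as_elim]
theorem ind {P : Forest A → Prop} (h0 : P 0)
    (h1 : ∀ a c s, P c → P s → P (tree a c + s)) (s : Forest A) : P s := by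
  induction s using Quotient.ind with
  | _ s =>
    induction s with
    | nil => exact h0
    | cons a c s ihc ihs => exact h1 a _ _ ihc ihs

/-- The set of trees of an ordered forest, as pairs of a root label and a forest of children. -/
def preRoots : PreForest A → Set (A × Forest A)
  | .nil => ∅
  | .cons a c s => insert (a, Quotient.mk _ c) (preRoots s)

/-- The set of trees of a forest, as pairs of a root label and a forest of children. -/
def roots (s : Forest A) : Set (A × Forest A) :=
  Quotient.lift
    preRoots
    (by
      intro s t h
      induction h with
      | refl s => rfl
      | symm _ ih => exact ih.symm
      | trans _ _ ih₁ ih₂ => exact ih₁.trans ih₂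
      | cons a hc _ _ ih =>
        exact congrArg₂ (fun x y => insert (a, x) y) (Quotient.sound hc) ih
      | swap a b c d s => exact Set.insert_comm _ _ _
      | dup a c s => exact Set.insert_idem _ _) s

theorem roots_zero : roots (0 : Forest A) = ∅ := rfl

theorem roots_tree_add (a : A) (c s : Forest A) :
    roots (tree a c + s) = insert (a, c) (roots s) := by
  induction c using Quotient.ind
  induction s using Quotient.ind
  rfl

theorem roots_tree (a : A) (c : Forest A) : roots (tree a c) = {(a, c)} := by
  rw [← add_zero (tree a c), roots_tree_add, roots_zero, insert_empty_eq]

theorem roots_add (s t : Forest A) : roots (s + t) = roots s ∪ roots t := by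
  refine ind (P := fun s => roots (s + t) = roots s ∪ roots t) ?_ ?_ s
  · simp [roots_zero]
  · intro a c s _ ih
    rw [add_assoc, roots_tree_add, roots_tree_add, ih, Set.insert_union]

theorem tree_add_of_mem {a : A} {c s : Forest A} (h : (a, c) ∈ roots s) : tree a c + s = s := by
  revert h
  refine ind (P := fun s => (a, c) ∈ roots s → tree a c + s = s) ?_ ?_ s
  · intro h; exact absurd h (by simp [roots_zero])
  · intro b d s _ ih h
    rw [roots_tree_add, Set.mem_insert_iff] at h
    rcases h with h | h
    · obtain ⟨rfl, rfl⟩ := Prod.mk.inj h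
      rw [← add_assoc, add_self]
    · rw [add_left_comm, ih h]

theorem add_of_roots_subset {s t : Forest A} (h : roots s ⊆ roots t) : s + t = t := by
  revert h
  refine ind (P := fun s => roots s ⊆ roots t → s + t = t) ?_ ?_ s
  · intro _; exact zero_add t
  · intro a c s _ ih h
    rw [roots_tree_add, Set.insert_subset_iff] at h
    rw [add_assoc, ih h.2, tree_add_of_mem h.1]

/-- A forest is determined by its set of trees. -/
theorem roots_injective : Function.Injective (roots (A := A)) := fun s t h => by
  rw [← add_of_roots_subset h.le, add_comm, add_of_roots_subset h.ge]

/-- The height of an ordered forest. -/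
def preHeight : PreForest A → ℕ
  | .nil => 0
  | .cons _ c s => max (preHeight c + 1) (preHeight s)

/-- The height of a forest: the number of nodes on a longest path. -/
def height (s : Forest A) : ℕ :=
  Quotient.lift preHeight
    (by
      intro s t h
      induction h with
      | refl s => rfl
      | symm _ ih => exact ih.symm
      | trans _ _ ih₁ ih₂ => exact ih₁.trans ih₂
      | cons a _ _ ih₁ ih₂ => exact congrArg₂ (fun x y => max (x + 1) y) ih₁ ih₂
      | swap a b c d s => exact max_left_comm _ _ _
      | dup a c s => exact max_eq_right (le_max_left _ _)) s

theorem height_zero : height (0 : Forest A) = 0 := rfl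

theorem height_tree_add (a : A) (c s : Forest A) :
    height (tree a c + s) = max (height c + 1) (height s) := by
  induction c using Quotient.ind
  induction s using Quotient.ind
  rfl

theorem height_tree (a : A) (c : Forest A) : height (tree a c) = height c + 1 := by
  rw [← add_zero (tree a c), height_tree_add, height_zero]; simp

theorem height_add (s t : Forest A) : height (s + t) = max (height s) (height t) := by
  refine ind (P := fun s => height (s + t) = max (height s) (height t)) ?_ ?_ s
  · simp [height_zero]
  · intro a c s _ ih
    rw [add_assoc, height_tree_add, height_tree_add, ih, max_assoc]

theorem height_lt_of_mem_roots {a : A} {c s : Forest A} (h : (a, c) ∈ roots s) :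
    height c < height s := by
  rw [← tree_add_of_mem h, height_tree_add]
  exact lt_of_lt_of_le (Nat.lt_succ_self _) (le_max_left _ _)

/-- A forest of given height over a nonempty alphabet. -/
theorem exists_height [Nonempty A] (n : ℕ) : ∃ c : Forest A, height c = n := by
  induction n with
  | zero => exact ⟨0, rfl⟩
  | succ n ih =>
    obtain ⟨c, hc⟩ := ih
    exact ⟨tree (Classical.arbitrary A) c, by rw [height_tree, hc]⟩

/-- Small forests can be read off from a sum with a single tall tree. -/
theorem add_tree_inj {a b : A} {c d s t : Forest A} (hsd : height s ≤ height d)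
    (htc : height t ≤ height c)
    (h : s + tree a c = t + tree b d) : s = t ∧ a = b ∧ c = d := by
  have hr : roots s ∪ {(a, c)} = roots t ∪ {(b, d)} := by
    rw [← roots_tree, ← roots_tree, ← roots_add, ← roots_add, h]
  have hs : ∀ {e f} {r : Forest A}, height r ≤ height f → (e, f) ∉ roots r := fun hr hm =>
    absurd (height_lt_of_mem_roots hm) (not_lt.mpr hr)
  have hac : (a, c) = (b, d) := by
    have : (a, c) ∈ roots t ∪ {(b, d)} := hr ▸ Or.inr rfl
    exact this.resolve_left (hs htc)
  refine ⟨roots_injective (Set.ext fun x => ⟨fun hx => ?_, fun hx => ?_⟩), Prod.mk.inj hac⟩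
  · have : x ∈ roots t ∪ {(b, d)} := hr ▸ Or.inl hx
    exact this.resolve_right fun hxe => hs hsd (by rw [← Set.mem_singleton_iff.mp hxe]; exact hx)
  · have : x ∈ roots s ∪ {(a, c)} := hr.symm ▸ Or.inl hx
    exact this.resolve_right fun hxe => hs htc (by rw [← Set.mem_singleton_iff.mp hxe]; exact hx)

end Forest

/-- Contexts over `A`: forests in which exactly one leaf is the variable `X`.  Such a forest is
either `s + X` or `s + a[c]`, where `s` is a forest without variable and `c` is a context, and `s`,
`a`, `c` are determined by it. -/
inductive ForestContext (A : Type u) : Type u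
  | hole (s : Forest A) : ForestContext A
  | node (s : Forest A) (a : A) (c : ForestContext A) : ForestContext A

namespace ForestContext

variable {A : Type u}

/-- Substitution of a forest for the variable. -/
def plug : ForestContext A → Forest A → Forest A
  | hole s, f => s + f
  | node s a c, f => s + Forest.tree a (plug c f)

/-- The context `s + c`. -/
def addForest (s : Forest A) : ForestContext A → ForestContext A
  | hole t => hole (s + t)
  | node t a c => node (s + t) a c

/-- Substitution of a context for the variable. -/
def comp : ForestContext A → ForestContext A → ForestContext A
  | hole s, d => addForest s d
  | node s a c, d => node s a (comp c d)

theorem plug_addForest (s : Forest A) (c : ForestContext A) (f : Forest A) :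
    plug (addForest s c) f = s + plug c f := by
  cases c <;> simp [plug, addForest, add_assoc]

theorem plug_comp (c d : ForestContext A) (f : Forest A) :
    plug (comp c d) f = plug c (plug d f) := by
  induction c with
  | hole s => exact plug_addForest s d f
  | node s a c ih => simp [comp, plug, ih]

instance : Monoid (ForestContext A) where
  mul := comp
  one := hole 0
  mul_assoc c d e := by
    change comp (comp c d) e = comp c (comp d e)
    induction c with
    | hole s => cases d <;> cases e <;> simp [comp, addForest, add_assoc]
    | node s a c ih => simp [comp, ih]
  one_mul c := by
    change addForest 0 c = c
    cases c <;> simp [addForest]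
  mul_one c := by
    change comp c (hole 0) = c
    induction c with
    | hole s => simp [comp, addForest]
    | node s a c ih => simp [comp, ih]

instance : MulAction (ForestContext A) (Forest A) where
  smul := plug
  one_smul f := zero_add f
  mul_smul c d f := plug_comp c d f

/-- An upper bound for the heights of the forests in a context. -/
def bound : ForestContext A → ℕ
  | hole s => s.height
  | node s _ c => max s.height (bound c)

theorem le_height_plug (c : ForestContext A) (f : Forest A) : f.height ≤ (plug c f).height := by
  induction c with
  | hole s => rw [plug, Forest.height_add]; exact le_max_right _ _
  | node s a c ih =>
    rw [plug, Forest.height_add, Forest.height_tree]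
    exact (ih.trans (Nat.le_succ _)).trans (le_max_right _ _)

theorem eq_of_plug_eq (a : A) (f : Forest A) (c d : ForestContext A) (hc : c.bound ≤ f.height)
    (hd : d.bound ≤ f.height) (h : plug c (Forest.tree a f) = plug d (Forest.tree a f)) :
    c = d := by
  have key : ∀ (s t : Forest A) (b : A) (e : ForestContext A), s.height ≤ f.height →
      plug (hole s) (Forest.tree a f) ≠ plug (node t b e) (Forest.tree a f) := by
    intro s t b e hs h
    have h1 := congrArg Forest.height h
    have h2 := le_height_plug e (Forest.tree a f)
    simp only [plug, Forest.height_add, Forest.height_tree] at h1 h2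
    omega
  induction c generalizing d with
  | hole s =>
    cases d with
    | hole t => rw [(Forest.add_tree_inj hc hd h).1]
    | node t b e => exact absurd h (key s t b e hc)
  | node s b c ih =>
    cases d with
    | hole t => exact absurd h.symm (key t s b c hd)
    | node t b' d =>
      have hc' := max_le_iff.mp hc
      have hd' := max_le_iff.mp hd
      have h1 := le_height_plug c (Forest.tree a f)
      have h2 := le_height_plug d (Forest.tree a f)
      rw [Forest.height_tree] at h1 h2
      obtain ⟨rfl, rfl, h3⟩ := Forest.add_tree_inj (by omega) (by omega) h
      rw [ih d hc'.2 hd'.2 h3]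

instance : FaithfulSMul (ForestContext A) (Forest A) where
  eq_of_smul_eq_smul {c d} h := by
    rcases isEmpty_or_nonempty A with hA | hA
    · have hF : ∀ s : Forest A, s = 0 :=
        Forest.ind rfl fun a => isEmptyElim a
      cases c with
      | node _ a _ => exact isEmptyElim a
      | hole s =>
        cases d with
        | node _ a _ => exact isEmptyElim a
        | hole t => rw [hF s, hF t]
    · obtain ⟨f, hf⟩ := Forest.exists_height (A := A) (max c.bound d.bound)
      exact eq_of_plug_eq (Classical.arbitrary A) f c d (hf ▸ le_max_left _ _)
        (hf ▸ le_max_right _ _) (h _)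

end ForestContext

/-- The free forest algebra over the alphabet `A`. -/
def freeForestAlgebra (A : Type u) : ForestAlgebra.{u, u} where
  H := Forest A
  V := ForestContext A
  add_idem := Forest.add_self
  ins := ForestContext.hole
  ins_smul _ _ := rfl
  exists_smul_zero h := ⟨ForestContext.hole h, (add_zero h).symm⟩

/-! ### The derived forest category -/

/-- The derived forest category `D_{α, β}` of two morphisms `α`, `β` from a free forest algebra.
Its objects are the forest types of `F₂`. -/
structure DerivedForestCategory (A : Type w) (F₁ : ForestAlgebra.{u₁, v₁})
    (F₂ : ForestAlgebra.{u₂, v₂}) where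
  α : (freeForestAlgebra A).Hom F₁
  β : (freeForestAlgebra A).Hom F₂
  α_surj : α.Surjective
  β_surj : β.Surjective

namespace DerivedForestCategory

variable {A : Type w} {F₁ : ForestAlgebra.{u₁, v₁}} {F₂ : ForestAlgebra.{u₂, v₂}}

open ForestAlgebra

/-- Objects. -/
abbrev Obj (_C : DerivedForestCategory A F₁ F₂) : Type u₂ := F₂.H

/-- The triples `(h, p, h')` with `β(p) h = h'`, for fixed `h` and `h'`. -/
def PreArr (C : DerivedForestCategory A F₁ F₂) (h h' : C.Obj) : Type w :=
  {p : (freeForestAlgebra A).V // C.β.mapV p • h = h'}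

/-- `(h, p, h') ∼ (h, q, h')` if `α(p s) = α(q s)` for all forests `s` with `β(s) = h`. -/
instance arrSetoid (C : DerivedForestCategory A F₁ F₂) (h h' : C.Obj) : Setoid (C.PreArr h h') where
  r p q := ∀ s : (freeForestAlgebra A).H, C.β.mapH s = h →
    C.α.mapH (p.1 • s) = C.α.mapH (q.1 • s)
  iseqv := ⟨fun _ _ _ => rfl, fun H s hs => (H s hs).symm,
    fun H H' s hs => (H s hs).trans (H' s hs)⟩

/-- Arrows from `h` to `h'`. -/
def Arr (C : DerivedForestCategory A F₁ F₂) (h h' : C.Obj) : Type w := Quotient (C.arrSetoid h h')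

/-- The arrow represented by `(h, p, h')`. -/
def Arr.mk (C : DerivedForestCategory A F₁ F₂) {h h' : C.Obj} (p : (freeForestAlgebra A).V)
    (hp : C.β.mapV p • h = h') : C.Arr h h' :=
  Quotient.mk _ ⟨p, hp⟩

/-- Half-arrows: the pairs `(α(s), β(s))` for forests `s`, a submonoid of `F₁.H × F₂.H`. -/
def HArr (C : DerivedForestCategory A F₁ F₂) : AddSubmonoid (F₁.H × F₂.H) :=
  AddMonoidHom.mrange (C.α.mapH.prod C.β.mapH)

/-- The object at which a half-arrow ends. -/
def tgt (C : DerivedForestCategory A F₁ F₂) (c : C.HArr) : C.Obj := c.1.2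

/-- The identity arrow. -/
def Arr.id (C : DerivedForestCategory A F₁ F₂) (h : C.Obj) : C.Arr h h :=
  Arr.mk C 1 (by rw [map_one, one_smul])

/-- Multiplication of arrows: `(h₂, p, h₃) (h₁, q, h₂) = (h₁, p q, h₃)`. -/
def Arr.comp {C : DerivedForestCategory A F₁ F₂} {h₁ h₂ h₃ : C.Obj} (f : C.Arr h₂ h₃)
    (e : C.Arr h₁ h₂) : C.Arr h₁ h₃ :=
  Quotient.map₂ (fun p q => ⟨p.1 * q.1, by rw [map_mul, mul_smul, q.2, p.2]⟩)
    (by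
      intro p p' hp q q' hq s hs
      change C.α.mapH ((p.1 * q.1) • s) = C.α.mapH ((p'.1 * q'.1) • s)
      rw [mul_smul, mul_smul, hp (q.1 • s) (by rw [C.β.map_smul, hs, q.2]), C.α.map_smul,
        hq s hs, C.α.map_smul _ (q'.1 • s), C.α.map_smul q'.1]) f e

/-- Action of an arrow on a half-arrow that ends where the arrow starts:
`(h₂, p, h₂') · (h₁, h₂) = (α(p) h₁, h₂')`. -/
def Arr.app {C : DerivedForestCategory A F₁ F₂} {h h' : C.Obj} (f : C.Arr h h') (c : C.HArr)
    (hc : C.tgt c = h) : C.HArr :=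
  Quotient.lift (s := C.arrSetoid h h')
    (fun p => (⟨(C.α.mapV p.1 • c.1.1, h'), by
      obtain ⟨s, hs⟩ := c.2
      refine ⟨p.1 • s, Prod.ext ?_ ?_⟩
      · exact (C.α.map_smul _ _).trans (by rw [← hs]; rfl)
      · have h2 : C.β.mapH s = h := (congrArg Prod.snd hs).trans hc
        exact (C.β.map_smul _ _).trans (by rw [h2, p.2])⟩ : C.HArr))
    (by
      intro p q hpq
      obtain ⟨s, hs⟩ := c.2
      have h1 : C.α.mapH s = c.1.1 := congrArg Prod.fst hs
      have h2 : C.β.mapH s = h := (congrArg Prod.snd hs).trans hc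
      refine Subtype.ext (Prod.ext ?_ rfl)
      change C.α.mapV p.1 • c.1.1 = C.α.mapV q.1 • c.1.1
      rw [← h1, ← C.α.map_smul, ← C.α.map_smul, hpq s h2]) f

theorem map_hadd_smul {G : ForestAlgebra.{u, v}} (φ : (freeForestAlgebra A).Hom G)
    (s : (freeForestAlgebra A).H) (p : (freeForestAlgebra A).V) (h : G.H) :
    φ.mapV ((freeForestAlgebra A).hadd s p) • h = φ.mapH s + φ.mapV p • h := by
  rw [hadd, map_mul, mul_smul, φ.map_ins, G.ins_smul]

/-- Sum of an arrow and a half-arrow: `(h, p, h') + (h₁, h₂) = (h, p + s, h' + h₂)`, where `s` is a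
forest with `α(s) = h₁` and `β(s) = h₂`; by `Arr.addHalf_mk` the choice of `s` is immaterial. -/
noncomputable def Arr.addHalf {C : DerivedForestCategory A F₁ F₂} {h h' : C.Obj} (f : C.Arr h h')
    (c : C.HArr) : C.Arr h (h' + C.tgt c) :=
  Quotient.map
    (fun p => ⟨(freeForestAlgebra A).hadd (Classical.choose c.2) p.1, by
      rw [map_hadd_smul, p.2, add_comm]
      exact congrArg (fun x : F₁.H × F₂.H => h' + x.2) (Classical.choose_spec c.2)⟩)
    (by
      intro p q hpq s hs
      change C.α.mapH ((freeForestAlgebra A).hadd _ p.1 • s)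
        = C.α.mapH ((freeForestAlgebra A).hadd _ q.1 • s)
      rw [C.α.map_smul, C.α.map_smul, map_hadd_smul, map_hadd_smul, ← C.α.map_smul,
        ← C.α.map_smul, hpq s hs]) f

theorem Arr.addHalf_mk {C : DerivedForestCategory A F₁ F₂} {h h' : C.Obj}
    (p : (freeForestAlgebra A).V) (hp : C.β.mapV p • h = h') (c : C.HArr)
    (s : (freeForestAlgebra A).H) (hs : (C.α.mapH s, C.β.mapH s) = c.1) :
    (Arr.mk C p hp).addHalf c = Arr.mk C ((freeForestAlgebra A).hadd s p)
      (by rw [map_hadd_smul, hp, add_comm]; exact congrArg (fun x : F₁.H × F₂.H => h' + x.2) hs) := by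
  refine Quotient.sound ?_
  intro r _
  change C.α.mapH ((freeForestAlgebra A).hadd _ p • r)
    = C.α.mapH ((freeForestAlgebra A).hadd s p • r)
  rw [C.α.map_smul, C.α.map_smul, map_hadd_smul, map_hadd_smul]
  have h1 : C.α.mapH (Classical.choose c.2) = c.1.1 :=
    congrArg Prod.fst (Classical.choose_spec c.2)
  rw [h1, show C.α.mapH s = c.1.1 from congrArg Prod.fst hs]

/-- Sum of a half-arrow and an arrow; the same arrow as `f + c`, with its end point written as
`h₂ + h'` instead of `h' + h₂`. -/
noncomputable def Arr.halfAdd {C : DerivedForestCategory A F₁ F₂} {h h' : C.Obj} (c : C.HArr)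
    (f : C.Arr h h') : C.Arr h (C.tgt c + h') :=
  Quotient.map (fun p => ⟨p.1, p.2.trans (add_comm _ _)⟩) (fun _ _ h => h) (f.addHalf c)

/-- A derived forest category is finite if it has finitely many objects, arrows and
half-arrows. -/
def IsFinite (C : DerivedForestCategory A F₁ F₂) : Prop :=
  Finite C.Obj ∧ Finite (Σ h h' : C.Obj, C.Arr h h') ∧ Finite C.HArr

theorem tgt_add {C : DerivedForestCategory A F₁ F₂} {h : C.Obj} {c d : C.HArr} (hc : C.tgt c = h)
    (hd : C.tgt d = h) : C.tgt (c + d) = h := by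
  change C.tgt c + C.tgt d = h
  rw [hc, hd, F₂.add_idem]

/-- `v (c + d) = v c + v d` for all arrows `v` from `h` to `h'` and all half-arrows `c`, `d` that
end in `h`. -/
def IsLocallyDistributive (C : DerivedForestCategory A F₁ F₂) : Prop :=
  ∀ (h h' : C.Obj) (v : C.Arr h h') (c d : C.HArr) (hc : C.tgt c = h) (hd : C.tgt d = h),
    v.app (c + d) (tgt_add hc hd) = v.app c hc + v.app d hd

/-- A division of the forest algebra `F` by the derived forest category `C`: nonempty sets of
forest types and context types of `F`, assigned to the half-arrows and arrows of `C`, that are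
compatible with the operations and disjoint for distinct half-arrows with the same end and for
distinct arrows with the same start and the same end. -/
structure Division (C : DerivedForestCategory A F₁ F₂) (F : ForestAlgebra.{u, v}) where
  KH : C.HArr → Set F.H
  KV : ∀ {x y : C.Obj}, C.Arr x y → Set F.V
  nonemptyH : ∀ c : C.HArr, (KH c).Nonempty
  nonemptyV : ∀ {x y : C.Obj} (e : C.Arr x y), (KV e).Nonempty
  comp : ∀ {x y z : C.Obj} (f : C.Arr y z) (e : C.Arr x y),
    ∀ v ∈ KV f, ∀ v' ∈ KV e, v * v' ∈ KV (f.comp e)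
  app : ∀ {x y : C.Obj} (e : C.Arr x y) (c : C.HArr) (hc : C.tgt c = x),
    ∀ v ∈ KV e, ∀ h ∈ KH c, v • h ∈ KH (e.app c hc)
  add : ∀ c d : C.HArr, ∀ h ∈ KH c, ∀ h' ∈ KH d, h + h' ∈ KH (c + d)
  halfAdd : ∀ {y z : C.Obj} (c : C.HArr) (f : C.Arr y z),
    ∀ h ∈ KH c, ∀ v ∈ KV f, F.hadd h v ∈ KV (Arr.halfAdd c f)
  addHalf : ∀ {y z : C.Obj} (f : C.Arr y z) (c : C.HArr),
    ∀ v ∈ KV f, ∀ h ∈ KH c, F.hadd h v ∈ KV (f.addHalf c)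
  injV : ∀ {x y : C.Obj} (e e' : C.Arr x y), e ≠ e' → KV e ∩ KV e' = ∅
  injH : ∀ c c' : C.HArr, C.tgt c = C.tgt c' → c ≠ c' → KH c ∩ KH c' = ∅

/-- `C ≺ F`: the derived forest category `C` divides the forest algebra `F`. -/
def Divides (C : DerivedForestCategory A F₁ F₂) (F : ForestAlgebra.{u, v}) : Prop :=
  Nonempty (C.Division F)

end DerivedForestCategory

/-! Order the half-arrows by c ≤ z iff c + z = z. A half-arrow c is determined by its upper bounds,
so it may be replaced by its code, the set of all z with c ≰ z. Since c + d is the join of c and d,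
coding turns sums into unions. It therefore embeds all half-arrows, whatever their ends, into a
finite power set under union (`code_add`, `code_injective`).

The target algebra consists of all union-preserving self-maps of that power set, which is
distributive by construction. It remains to realise each arrow e from x by such a map
(`exists_additive_code_app`). Fix z. By local distributivity the half-arrows c ending in x with e·c
≤ z are closed under sums; by finiteness, if there are any, they have a greatest element m(z). As e
is monotone on half-arrows ending in x, e·c ≤ z iff c ≤ m(z): the action of e has a partial adjoint.
Thus z lies in the code of e·c iff m(z) lies in the code of c, and taking preimages under m
preserves unions. Arrows with the same start and end that act alike on half-arrows coincide
(`arr_ext`), which gives the disjointness required of a division. -/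

/-! ### Distributive algebras of additive maps -/

namespace ForestAlgebra

/-- The distributive forest algebra of all additive maps (not necessarily fixing `0`) on a
commutative idempotent monoid `M`. -/
def ofAdditiveMaps (M : Type u) [AddCommMonoid M] (h_idem : ∀ x : M, x + x = x) :
    ForestAlgebra.{u, u} where
  H := M
  V := ({ carrier := {f | ∀ x y, f (x + y) = f x + f y}
          one_mem' := fun _ _ => rfl
          mul_mem' := fun {f g} hf hg x y => (congrArg f (hg x y)).trans (hf _ _) } :
        Submonoid (Function.End M))
  add_idem := h_idem
  -- Translation by h is additive because h + h = h. It moves 0 in general, so the maps in `V`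
  -- cannot be required to fix 0.
  ins h := ⟨fun x => h + x, fun x y => by rw [add_add_add_comm, h_idem]⟩
  ins_smul _ _ := rfl
  exists_smul_zero h := ⟨⟨fun x => h + x, fun x y => by rw [add_add_add_comm, h_idem]⟩,
    (add_zero h).symm⟩

variable {M : Type u} [AddCommMonoid M] {h_idem : ∀ x : M, x + x = x}

theorem ofAdditiveMaps_isDistributive : (ofAdditiveMaps M h_idem).IsDistributive :=
  fun v => v.2

theorem ofAdditiveMaps_isFinite [Finite M] : (ofAdditiveMaps M h_idem).IsFinite :=
  ⟨inferInstanceAs (Finite M), Finite.of_injective (β := M → M) Subtype.val Subtype.val_injective⟩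

end ForestAlgebra

/-! ### Power sets under union, and greatest elements -/

namespace SetSemiring

theorem add_self {ι : Type u} (X : SetSemiring ι) : X + X = X := Set.union_self (SetSemiring.down X)

instance {ι : Type u} [Finite ι] : Finite (SetSemiring ι) := inferInstanceAs (Finite (Set ι))

end SetSemiring

/-- A nonempty finite subset of a commutative idempotent monoid that is closed under addition has
a greatest element for the order `x ≤ y ↔ x + y = y`. -/
theorem exists_add_eq_of_add_mem {M : Type u} [AddCommMonoid M] [Finite M]
    (h_idem : ∀ x : M, x + x = x) {S : Set M} (hS : S.Nonempty)
    (h_add : ∀ x ∈ S, ∀ y ∈ S, x + y ∈ S) : ∃ m ∈ S, ∀ x ∈ S, x + m = m := by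
  -- The bound of T is sought in S rather than in T, so that T = ∅ is a valid start of the
  -- induction.
  have key : ∀ T : Set M, T.Finite → T ⊆ S → ∃ m ∈ S, ∀ x ∈ T, x + m = m := by
    intro T hT
    induction T, hT using Set.Finite.induction_on with
    | empty => exact fun _ => ⟨hS.some, hS.some_mem, fun _ h => h.elim⟩
    | @insert a T _ _ ih =>
      intro h
      obtain ⟨m, hm, hmT⟩ := ih ((Set.subset_insert a T).trans h)
      refine ⟨a + m, h_add _ (h (Set.mem_insert a T)) _ hm, ?_⟩
      rintro x (rfl | hx)
      · rw [← add_assoc, h_idem]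
      · rw [add_left_comm, hmT x hx]
  exact key S S.toFinite subset_rfl

/-! ### Arrows as maps on half-arrows -/

namespace DerivedForestCategory

open ForestAlgebra

variable {A : Type w} {F₁ : ForestAlgebra.{u₁, v₁}} {F₂ : ForestAlgebra.{u₂, v₂}}
  {C : DerivedForestCategory A F₁ F₂}

theorem hArr_add_self (c : C.HArr) : c + c = c :=
  Subtype.ext (Prod.ext (F₁.add_idem _) (F₂.add_idem _))

theorem tgt_app {x y : C.Obj} (e : C.Arr x y) (c : C.HArr) (hc : C.tgt c = x) :
    C.tgt (e.app c hc) = y := by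
  induction e using Quotient.ind
  rfl

theorem comp_app {x y z : C.Obj} (f : C.Arr y z) (e : C.Arr x y) (c : C.HArr)
    (hc : C.tgt c = x) : (f.comp e).app c hc = f.app (e.app c hc) (tgt_app e c hc) := by
  induction e using Quotient.ind
  induction f using Quotient.ind
  refine Subtype.ext (Prod.ext ?_ rfl)
  exact (congrArg (· • c.1.1) (map_mul C.α.mapV _ _)).trans (mul_smul _ _ _)

theorem addHalf_app {x y : C.Obj} (f : C.Arr x y) (d c : C.HArr) (hc : C.tgt c = x) :
    (f.addHalf d).app c hc = d + f.app c hc := by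
  induction f using Quotient.ind with
  | _ p =>
    obtain ⟨s, hs⟩ := d.2
    -- With the class written through `Arr.mk`, the forest chosen inside `addHalf` can be exchanged
    -- for s.
    change ((Arr.mk C p.1 p.2).addHalf d).app c hc = _
    rw [Arr.addHalf_mk p.1 p.2 d s hs]
    refine Subtype.ext (Prod.ext ?_ (add_comm _ _))
    exact (map_hadd_smul C.α s p.1 c.1.1).trans
      (congrArg (fun x : F₁.H × F₂.H => x.1 + C.α.mapV p.1 • c.1.1) hs)

/-- `halfAdd` and `addHalf` differ only in how the end object is written, which the action sees only
up to commutativity. -/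
theorem halfAdd_app {x y : C.Obj} (f : C.Arr x y) (d c : C.HArr) (hc : C.tgt c = x) :
    (Arr.halfAdd d f).app c hc = d + f.app c hc := by
  rw [← addHalf_app]
  unfold Arr.halfAdd
  generalize f.addHalf d = g
  induction g using Quotient.ind
  exact Subtype.ext (Prod.ext rfl (add_comm _ _))

/-- Arrows with the same start and end are determined by their action on half-arrows. -/
theorem arr_ext {x y : C.Obj} {e e' : C.Arr x y}
    (h : ∀ (c : C.HArr) (hc : C.tgt c = x), e.app c hc = e'.app c hc) : e = e' := by
  induction e using Quotient.ind with
  | _ p =>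
    induction e' using Quotient.ind with
    | _ q =>
      refine Quotient.sound fun s hs => ?_
      rw [C.α.map_smul, C.α.map_smul]
      exact congrArg (fun c : C.HArr => c.1.1) (h ⟨(C.α.mapH s, C.β.mapH s), s, rfl⟩ hs)

/-! ### Coding half-arrows by sets and arrows by additive maps -/

section Code

variable {ι : Type} (ν : ι ≃ C.HArr)

/-- The set of (indices of) half-arrows that do not lie above `c`. -/
def code (c : C.HArr) : SetSemiring ι := Set.up {i | ¬ c + ν i = ν i}

theorem mem_code {c : C.HArr} {i : ι} :
    i ∈ SetSemiring.down (code ν c) ↔ ¬ c + ν i = ν i := Iff.rfl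

/-- By idempotence z is above c + d iff it is above both c and d; complementing turns this
intersection into a union. -/
theorem code_add (c d : C.HArr) : code ν (c + d) = code ν c + code ν d := by
  have key : ∀ z : C.HArr, c + d + z = z ↔ c + z = z ∧ d + z = z := by
    refine fun z => ⟨fun h => ⟨?_, ?_⟩, fun h => by rw [add_assoc, h.2, h.1]⟩
    · rw [← h, ← add_assoc, ← add_assoc, hArr_add_self]
    · rw [← h, add_assoc c, add_left_comm, ← add_assoc d, hArr_add_self]
  change {i | ¬ c + d + ν i = ν i} = {i | ¬ c + ν i = ν i} ∪ {i | ¬ d + ν i = ν i}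
  ext i
  simp only [Set.mem_ofPred_eq, Set.mem_union, key, not_and_or]

/-- Equal codes mean equal sets of upper bounds, so each of c and d lies above the other. -/
theorem code_injective : Function.Injective (code ν) := by
  intro c d h
  have key : ∀ z : C.HArr, c + z = z ↔ d + z = z := fun z => by
    have := congrArg (fun X => ν.symm z ∈ SetSemiring.down X) h
    simpa only [mem_code, Equiv.apply_symm_apply, eq_iff_iff, not_iff_not] using this
  rw [← (key d).mpr (hArr_add_self d), add_comm, (key c).mp (hArr_add_self c)]

/-- By local distributivity the half-arrows `c` with `e · c ≤ z` have a greatest element if there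
are any; hence the action of `e` on half-arrows extends to an additive map on codes. -/
theorem exists_additive_code_app [Finite C.HArr] (hloc : C.IsLocallyDistributive) {x y : C.Obj}
    (e : C.Arr x y) :
    ∃ f : SetSemiring ι → SetSemiring ι, (∀ X Y, f (X + Y) = f X + f Y) ∧
      ∀ (c : C.HArr) (hc : C.tgt c = x), f (code ν c) = code ν (e.app c hc) := by
  have hmax : ∀ z : C.HArr, (∃ m : C.HArr, ∀ (c : C.HArr) (hc : C.tgt c = x),
      e.app c hc + z = z ↔ c + m = m) ∨ ∀ (c : C.HArr) (hc : C.tgt c = x), e.app c hc + z ≠ z := by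
    intro z
    by_cases hne : {c : C.HArr | ∃ hc : C.tgt c = x, e.app c hc + z = z}.Nonempty
    · left
      -- Closure under sums: e·(c + d) = e·c + e·d ≤ z.
      obtain ⟨m, ⟨hm, hmz⟩, hmax⟩ := exists_add_eq_of_add_mem hArr_add_self hne (by
        rintro c ⟨hc, hcz⟩ d ⟨hd, hdz⟩
        exact ⟨tgt_add hc hd, by rw [hloc _ _ _ _ _ hc hd, add_assoc, hdz, hcz]⟩)
      refine ⟨m, fun c hc => ⟨fun h => hmax c ⟨hc, h⟩, fun h => ?_⟩⟩
      -- Monotonicity of e: from c + m = m follows e·c + e·m = e·(c + m) = e·m.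
      have h1 : e.app c hc + e.app m hm = e.app m hm := by
        rw [← hloc]
        congr 1
      rw [← hmz, ← add_assoc, h1]
    · exact .inr fun c hc h => hne ⟨c, hc, h⟩
  choose! m hm using fun z (h : ∃ m : C.HArr, ∀ (c : C.HArr) (hc : C.tgt c = x),
    e.app c hc + z = z ↔ c + m = m) => h
  -- The preimage of X under m, enlarged by every z that is above no e·c. Such z lie in the code of
  -- every e·c, and the premise keeps arbitrary values of m from mattering. An implication with a
  -- fixed premise distributes over disjunction, hence additivity.
  refine ⟨fun X => Set.up {i | (∃ c, ∃ hc : C.tgt c = x, e.app c hc + ν i = ν i) →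
    ν.symm (m (ν i)) ∈ SetSemiring.down X}, fun X Y => ?_, fun c hc => ?_⟩
  · change {i | _ → ν.symm (m (ν i)) ∈ SetSemiring.down X ∪ SetSemiring.down Y} =
      {i | _ → ν.symm (m (ν i)) ∈ SetSemiring.down X} ∪
      {i | _ → ν.symm (m (ν i)) ∈ SetSemiring.down Y}
    ext i
    exact imp_or
  · change {i | _ → ν.symm (m (ν i)) ∈ SetSemiring.down (code ν c)} =
      {i | ¬ e.app c hc + ν i = ν i}
    ext i
    simp only [Set.mem_ofPred_eq, mem_code, Equiv.apply_symm_apply]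
    rcases hmax (ν i) with h | h
    · rw [hm _ h c hc]
      refine ⟨fun h' hcm => h' ⟨c, hc, (hm _ h c hc).mpr hcm⟩ hcm, fun h' _ => h'⟩
    · exact iff_of_true (fun ⟨d, hd, hdz⟩ => absurd hdz (h d hd)) (h c hc)

/-- The division that relates each half-arrow to its code and each arrow to the additive maps that
act on the codes of half-arrows as it does. -/
def codeDivision [Finite C.HArr] (hloc : C.IsLocallyDistributive) :
    C.Division (ofAdditiveMaps (SetSemiring ι) SetSemiring.add_self) where
  KH c := {code ν c}
  -- Only the values on codes of half-arrows ending in x are prescribed. They already determine e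
  -- among the arrows with its start and end.
  KV {x _} e := {v | ∀ (c : C.HArr) (hc : C.tgt c = x), v.1 (code ν c) = code ν (e.app c hc)}
  nonemptyH c := ⟨_, rfl⟩
  nonemptyV e :=
    let ⟨f, hf, hfe⟩ := exists_additive_code_app ν hloc e
    ⟨⟨f, hf⟩, hfe⟩
  comp f e v hv v' hv' c hc := by
    rw [comp_app, ← hv, ← hv']
    rfl
  app e c hc v hv h hh := by
    rw [Set.mem_singleton_iff.mp hh]
    exact hv c hc
  add c d h hh h' hh' := by
    rw [Set.mem_singleton_iff.mp hh, Set.mem_singleton_iff.mp hh']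
    exact (code_add ν c d).symm
  halfAdd d f h hh v hv c hc := by
    rw [halfAdd_app, code_add, ← hv, Set.mem_singleton_iff.mp hh]
    rfl
  addHalf f d v hv h hh c hc := by
    rw [addHalf_app, code_add, ← hv, Set.mem_singleton_iff.mp hh]
    rfl
  injV e e' hne := Set.eq_empty_iff_forall_notMem.mpr fun v hv =>
    hne (arr_ext fun c hc => code_injective ν ((hv.1 c hc).symm.trans (hv.2 c hc)))
  injH c c' _ hne := Set.eq_empty_iff_forall_notMem.mpr fun h hh =>
    hne (code_injective ν ((Set.mem_singleton_iff.mp hh.1).symm.trans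
      (Set.mem_singleton_iff.mp hh.2)))

end Code

end DerivedForestCategory

theorem mainTheorem4 {A : Type w} [Finite A] {F₁ : ForestAlgebra.{u₁, v₁}}
    {F₂ : ForestAlgebra.{u₂, v₂}} (C : DerivedForestCategory A F₁ F₂) (hfin : C.IsFinite)
    (hloc : C.IsLocallyDistributive) :
    ∃ F : ForestAlgebra.{0, 0}, F.IsFinite ∧ F.IsDistributive ∧ C.Divides F := by
  have := hfin.2.2
  exact ⟨_, ForestAlgebra.ofAdditiveMaps_isFinite, ForestAlgebra.ofAdditiveMaps_isDistributive,
    -- Indexing the finitely many half-arrows by `Fin n` places the algebra in universe 0.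
    ⟨DerivedForestCategory.codeDivision (Finite.equivFin C.HArr).symm hloc⟩⟩
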